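/- Let $E$ be a Radon topological space (homeomorphic to a universally measurable subset of a compact metric space), let $\mathcal E^u$ be its universally measurable $\sigma$-algebra, and let $(P_t)_{t\ge 0}$ be a normal Markov transition function on $(E,\mathcal E^u)$, i.e. a semigroup of Markov kernels with $P_0(x,\cdot)=\delta_x$, with resolvent $U^\alpha f(x)=\int_0^\infty e^{-\alpha t}P_tf(x)\,dt$. A Markov transition function on a Radon space is said to satisfy (HD1) if for every probability measure $\mu$ on the space there is, on some filtered probability space, an adapted process with right-continuous paths and initial law $\mu$ that has the (simple) Markov property with this transition function (all with respect to the universally measurable $\sigma$-algebra). Assume that $(P_t)$ satisfies (HD1). Let $\Omega$ be the space of right-continuous maps $[0,\infty)\to E$ with coordinate process $(X_t)$ and the $\sigma$-algebra $\mathcal F^u=\sigma\{f(X_t): t\ge 0,\ f\ \mathcal E^u\text{-measurable}\}$; let $\mathbf P^x$ ($x\in E$) be the probability measure on $(\Omega,\mathcal F^u)$ under which $X_0=x$ almost surely and $(X_t)$ is Markov with transition function $(P_t)$ relative to its natural filtration, and put $\mathbf P^\mu=\int_E\mu(dx)\,\mathbf P^x$. Let $N\in\mathcal E^u$ be weakly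 $U$-negligible, i.e. $U^\alpha 1_N(x)=0$ for all $x\in E\setminus N$, for one (equivalently, all) $\alpha>0$. Give $\tilde E=E\setminus N$ the subspace topology and its universally measurable $\sigma$-algebra $\tilde{\mathcal E}^u$, and let $(\tilde U^\alpha)_{\alpha>0}$ be the restriction of $(U^\alpha)$ to $\tilde E$: $\tilde U^\alpha\tilde f=(U^\alpha f)|_{\tilde E}$ for $\tilde f:\tilde E\to[0,\infty]$ $\tilde{\mathcal E}^u$-measurable and $f$ any $\mathcal E^u$-measurable extension of $\tilde f$ to $E$ with values in $[0,\infty]$. If there is a probability measure $\mu$ on $E$ with $\mu(N)=0$ such that $\{X_t\notin N\ \text{for all } t\ge 0\}$ does not have full $\mathbf P^\mu$-outer measure, then there is no Markov transition function on $(\tilde E,\tilde{\mathcal E}^u)$ that satisfies (HD1) and has resolvent $(\tilde U^\alpha)_{\alpha>0}$. -/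

import Mathlib

open MeasureTheory ProbabilityTheory Set
open scoped NNReal ENNReal

universe u

noncomputable section

/-- The universally measurable `σ`-algebra of a topological space: the intersection, over all
finite Borel measures, of the completions of the Borel `σ`-algebra. -/
@[reducible] def univBorel (E : Type u) [TopologicalSpace E] : MeasurableSpace E where
  MeasurableSet' s := ∀ μ : @Measure E (borel E), @IsFiniteMeasure E (borel E) μ →
    @NullMeasurableSet E (borel E) s μ
  measurableSet_empty := fun μ _ => @MeasureTheory.nullMeasurableSet_empty E (borel E) μ
  measurableSet_compl := fun _ hs μ hμ =>
    @MeasureTheory.NullMeasurableSet.compl E (borel E) μ _ (hs μ hμ)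
  measurableSet_iUnion := fun _ hs μ hμ =>
    @MeasureTheory.NullMeasurableSet.iUnion E (borel E) μ _ _ _ (fun i => hs i μ hμ)

/-- A Radon topological space: homeomorphic to a universally measurable subset of a compact
metric space. -/
def IsRadonSpace (E : Type u) [TopologicalSpace E] : Prop :=
  ∃ (K : Type u) (_ : MetricSpace K) (_ : CompactSpace K) (i : E → K),
    Topology.IsEmbedding i ∧ MeasurableSet[univBorel K] (range i)

/-- Right continuity on `[0, ∞)`. -/
def IsRightContinuous {E : Type u} [TopologicalSpace E] (w : ℝ≥0 → E) : Prop :=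
  ∀ t, ContinuousWithinAt w (Ici t) t

/-- A Markov transition function on `E` with its universally measurable `σ`-algebra. -/
structure MarkovTransitionFunction (E : Type u) [TopologicalSpace E] where
  kernel : ℝ≥0 → @Kernel E E (univBorel E) (univBorel E)
  markov : ∀ t, @IsMarkovKernel E E (univBorel E) (univBorel E) (kernel t)
  chapman_kolmogorov : ∀ (t s : ℝ≥0) (x : E) (B : Set E), MeasurableSet[univBorel E] B →
    kernel (t + s) x B = ∫⁻ y, kernel s y B ∂(kernel t x)

/-- The process `X`, adapted to `𝓖`, satisfies the Markov property relative to the filtration `𝓖`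
and the transition function `P` under `Pr`:
`𝔼[f (X (t + s)) | 𝓖 t] = (P_s f)(X t)` for bounded universally measurable `f`. -/
structure IsMarkovProcess {E : Type u} [TopologicalSpace E] (P : MarkovTransitionFunction E)
    {Ω : Type u} {mΩ : MeasurableSpace Ω} (Pr : Measure Ω) (𝓖 : Filtration ℝ≥0 mΩ)
    (X : ℝ≥0 → Ω → E) : Prop where
  adapted : ∀ t, Measurable[𝓖 t, univBorel E] (X t)
  markov_property : ∀ (t s : ℝ≥0) (f : E → ℝ), @Measurable E ℝ (univBorel E) _ f →
    (∃ C : ℝ, ∀ x, |f x| ≤ C) →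
    condExp (𝓖 t) Pr (fun ω => f (X (t + s) ω)) =ᵐ[Pr] fun ω => ∫ y, f y ∂(P.kernel s (X t ω))

namespace MarkovTransitionFunction

variable {E : Type u} [TopologicalSpace E]

/-- Normality: `P_0(x, ·)` is the Dirac mass at `x`. -/
def IsNormal (P : MarkovTransitionFunction E) : Prop :=
  ∀ (x : E) (B : Set E), MeasurableSet[univBorel E] B →
    P.kernel 0 x B = B.indicator (fun _ => (1 : ℝ≥0∞)) x

/-- The hypothesis (HD1): for every initial law `μ` there is a right continuous Markov process on
some filtered probability space with transition function `P` and initial law `μ`. -/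
def HD1 (P : MarkovTransitionFunction E) : Prop :=
  ∀ μ : @Measure E (univBorel E), @IsProbabilityMeasure E (univBorel E) μ →
    ∃ (Ω : Type u) (mΩ : MeasurableSpace Ω) (Pr : Measure Ω) (𝓖 : Filtration ℝ≥0 mΩ)
      (X : ℝ≥0 → Ω → E),
      IsProbabilityMeasure Pr ∧ (∀ ω, IsRightContinuous fun t => X t ω) ∧
      IsMarkovProcess P Pr 𝓖 X ∧ @Measure.map Ω E mΩ (univBorel E) (X 0) Pr = μ

/-- The resolvent `U^α f (x) = ∫₀^∞ e^{-α t} P_t f (x) dt`. -/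
def resolvent (P : MarkovTransitionFunction E) (α : ℝ) (f : E → ℝ≥0∞) (x : E) : ℝ≥0∞ :=
  ∫⁻ t in Ioi (0 : ℝ), ENNReal.ofReal (Real.exp (-α * t)) * ∫⁻ y, f y ∂(P.kernel t.toNNReal x)

/-- `N` is weakly `U`-negligible: it is universally measurable and `U^α 1_N = 0` off `N` for one
(equivalently, for all) `α > 0`. -/
def IsWeaklyNegligible (P : MarkovTransitionFunction E) (N : Set E) : Prop :=
  MeasurableSet[univBorel E] N ∧
    ∃ α : ℝ, 0 < α ∧ ∀ x, x ∉ N → P.resolvent α (N.indicator fun _ => 1) x = 0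

/-- The restriction of the resolvent to `E \ N`: extend `f` from `E \ N` to `E`, apply `U^α`, and
restrict to `E \ N`. The extension used is by zero; when `N` is weakly `U`-negligible, every
universally measurable extension gives the same value. -/
def restrictedResolvent (P : MarkovTransitionFunction E) (N : Set E) (α : ℝ)
    (f : (Nᶜ : Set E) → ℝ≥0∞) (x : (Nᶜ : Set E)) : ℝ≥0∞ :=
  P.resolvent α (Function.extend Subtype.val f 0) x

end MarkovTransitionFunction

/-- The space of all right continuous maps from `[0, ∞)` to `E`. -/
def PathSpace (E : Type u) [TopologicalSpace E] : Type u := {w : ℝ≥0 → E // IsRightContinuous w}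

namespace PathSpace

variable {E : Type u} [TopologicalSpace E]

/-- The coordinate process. -/
def coord (t : ℝ≥0) (ω : PathSpace E) : E := ω.1 t

/-- The `σ`-algebra generated by all coordinates, with respect to the universally measurable
`σ`-algebra of `E`. -/
instance : MeasurableSpace (PathSpace E) := ⨆ t, (univBorel E).comap (coord t)

/-- The (unaugmented) natural filtration of the coordinate process. -/
def naturalFiltration (E : Type u) [TopologicalSpace E] :
    Filtration ℝ≥0 (inferInstance : MeasurableSpace (PathSpace E)) where
  seq t := ⨆ (s : ℝ≥0) (_ : s ≤ t), (univBorel E).comap (coord s)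
  mono' _ _ h := iSup₂_le fun s hs => le_iSup₂_of_le s (hs.trans h) le_rfl
  le' _ := iSup₂_le fun s _ => le_iSup (fun s => (univBorel E).comap (coord s)) s

end PathSpace

/-- The canonical realization of `P`: laws `P^x`, `x ∈ E`, on the path space, under which the
coordinate process starts at `x` and is Markov with transition function `P` relative to its natural
filtration. (The shift operators `(θ_t ω)(s) = ω (t + s)` of the path space satisfy the
identities required of them automatically.) -/
structure CanonicalRealization {E : Type u} [TopologicalSpace E]
    (P : MarkovTransitionFunction E) where
  law : E → Measure (PathSpace E)
  isProbabilityMeasure : ∀ x, IsProbabilityMeasure (law x)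
  start : ∀ x, law x {ω | PathSpace.coord 0 ω = x} = 1
  isMarkovProcess : ∀ x,
    IsMarkovProcess P (law x) (PathSpace.naturalFiltration E) PathSpace.coord

theorem borel_le_univBorel {E : Type u} [TopologicalSpace E] : borel E ≤ univBorel E :=
  fun _ hs μ _ => @MeasurableSet.nullMeasurableSet E (borel E) μ _ hs

theorem exists_canonical_law {E : Type u} [TopologicalSpace E] (hE : IsRadonSpace E) (P : MarkovTransitionFunction E)
    (h : P.HD1) (x : E) : ∃ L : Measure (PathSpace E), IsProbabilityMeasure L ∧
      L {ω | PathSpace.coord 0 ω = x} = 1 ∧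
      IsMarkovProcess P L (PathSpace.naturalFiltration E) PathSpace.coord := by
  have hx : MeasurableSet[univBorel E] (Set.singleton x) := by
    obtain ⟨K, _, _, i, hi, -⟩ := hE
    have : T1Space E := hi.t1Space
    exact borel_le_univBorel _ (@IsClosed.measurableSet E (Set.singleton x) _ (borel E) (@OpensMeasurableSpace.mk E _ (borel E) le_rfl) isClosed_singleton)
  obtain ⟨Ω, mΩ, Pr, 𝓖, X, hPr, hr, hX, h0⟩ := h (@Measure.dirac E (univBorel E) x)
    (@Measure.dirac.isProbabilityMeasure E (univBorel E) x)
  let Φ : Ω → PathSpace E := fun ω => ⟨fun t => X t ω, hr ω⟩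
  have hΦt : ∀ t, @Measurable Ω (PathSpace E) (𝓖 t) (PathSpace.naturalFiltration E t) Φ := by
    intro t
    rw [measurable_iff_comap_le]
    change MeasurableSpace.comap Φ (⨆ (s : ℝ≥0) (_ : s ≤ t), (univBorel E).comap (PathSpace.coord s)) ≤ _
    simp only [MeasurableSpace.comap_iSup, MeasurableSpace.comap_comp]
    exact iSup₂_le fun s hs => ((hX.adapted s).comap_le).trans (𝓖.mono hs)
  have hΦ : Measurable Φ := by
    rw [measurable_iff_comap_le]
    change MeasurableSpace.comap Φ (⨆ t : ℝ≥0, (univBorel E).comap (PathSpace.coord t)) ≤ _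
    simp only [MeasurableSpace.comap_iSup, MeasurableSpace.comap_comp]
    exact iSup_le fun s => ((hX.adapted s).comap_le).trans (𝓖.le s)
  have hco : ∀ t, Measurable[PathSpace.naturalFiltration E t, univBorel E] (PathSpace.coord (E := E) t) := by
    intro t
    rw [measurable_iff_comap_le]
    exact le_iSup₂_of_le (f := fun (s : ℝ≥0) (_ : s ≤ t) => (univBorel E).comap (PathSpace.coord (E := E) s)) t le_rfl le_rfl
  have hco' : ∀ t, @Measurable _ _ _ (univBorel E) (PathSpace.coord (E := E) t) :=
    fun t => (hco t).mono ((PathSpace.naturalFiltration E).le t) le_rfl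
  have hL : IsProbabilityMeasure (Pr.map Φ) := Measure.isProbabilityMeasure_map hΦ.aemeasurable
  refine ⟨Pr.map Φ, hL, ?_, hco, ?_⟩
  · change Pr.map Φ (PathSpace.coord 0 ⁻¹' (Set.singleton x)) = 1
    rw [Measure.map_apply hΦ (hco' 0 hx)]
    change Pr (X 0 ⁻¹' (Set.singleton x)) = 1
    have := congrArg (fun m : @Measure E (univBorel E) => m (Set.singleton x)) h0
    rw [@Measure.map_apply Ω E mΩ (univBorel E) _ _ ((hX.adapted 0).mono (𝓖.le 0) le_rfl) _ hx,
      @Measure.dirac_apply' E (univBorel E) _ _ hx] at this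
    rw [this]; exact Set.indicator_of_mem (show x ∈ Set.singleton x from rfl) _
  · intro t s f hf ⟨C, hC⟩
    let := univBorel E
    have := P.markov s
    have hg : Measurable fun y => ∫ z, f z ∂(P.kernel s y) :=
      (hf.stronglyMeasurable.integral_kernel).measurable
    have hgC : ∀ y, |∫ z, f z ∂(P.kernel s y)| ≤ C := fun y => by
      have := norm_integral_le_of_norm_le_const (μ := P.kernel s y) (f := f) (C := C)
        (Filter.Eventually.of_forall hC)
      simpa using this
    have int : ∀ (g : E → ℝ) (r : ℝ≥0), Measurable g → (∀ y, |g y| ≤ C) →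
        Integrable (fun ω => g (PathSpace.coord r ω)) (Pr.map Φ) := fun g r hg hC =>
      Integrable.of_bound (hg.comp (hco' r)).aestronglyMeasurable C (Filter.Eventually.of_forall fun ω => hC _)
    symm
    refine ae_eq_condExp_of_forall_setIntegral_eq ((PathSpace.naturalFiltration E).le t) (int f _ hf hC)
      (fun A hA _ => (int _ t hg hgC).integrableOn) (fun A hA _ => ?_)
      ((hg.comp (hco t)).stronglyMeasurable.aestronglyMeasurable)
    have hA' := (PathSpace.naturalFiltration E).le t _ hA
    rw [setIntegral_map hA' (int _ t hg hgC).1 hΦ.aemeasurable, setIntegral_map hA' (int f _ hf hC).1 hΦ.aemeasurable]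
    have h1 := hX.markov_property t s f hf ⟨C, hC⟩
    change ∫ ω in Φ ⁻¹' A, (∫ z, f z ∂(P.kernel s (X t ω))) ∂Pr = ∫ ω in Φ ⁻¹' A, f (X (t+s) ω) ∂Pr
    have key := setIntegral_condExp (𝓖.le t) (Integrable.of_bound (μ := Pr) (f := fun ω => f (X (t+s) ω)) (hf.comp ((hX.adapted (t+s)).mono (𝓖.le _) le_rfl)).aestronglyMeasurable C (Filter.Eventually.of_forall fun ω => hC _)) (hΦt t hA)
    refine Eq.trans ?_ key
    exact integral_congr_ae (ae_restrict_of_ae h1.symm)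

/-- Under (HD1) a canonical realization exists. -/
theorem CanonicalRealization.nonempty {E : Type u} [TopologicalSpace E] (hE : IsRadonSpace E)
    (P : MarkovTransitionFunction E) (h : P.HD1) : Nonempty (CanonicalRealization P) := by
  choose L h1 h2 h3 using exists_canonical_law hE P h
  exact ⟨⟨L, h1, h2, h3⟩⟩

/-- The law `P^μ = ∫ μ(dx) P^x` on the path space. -/
def CanonicalRealization.lawOf {E : Type u} [TopologicalSpace E] {P : MarkovTransitionFunction E}
    (X : CanonicalRealization P) (μ : @Measure E (univBorel E)) : Measure (PathSpace E) :=
  @Measure.bind E (PathSpace E) (univBorel E) _ μ X.law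

end

section

open Filter Topology
open scoped BoundedContinuousFunction

/-! Suppose a transition function `Q` on `Nᶜ` with (HD1) had the restricted resolvent. For `x ∉ N`
and `g` bounded continuous on `E`, (HD1) makes both `t ↦ P_t g(x)` and `t ↦ Q_t g(x)` right
continuous. Equal resolvents are equal Laplace transforms, so the two functions agree for every `t`,
and `P_t(x, ·)` is the image of `Q_t(x, ·)` under the inclusion (`map_val_kernel_eq`).

Now run a right continuous `Q`-process whose initial law is the restriction of `μ`. Viewed in `E`,
it is a right continuous `P`-Markov process with initial law `μ` that never meets `N`. A Markov
process's transition function and initial law determine its finite-dimensional distributions, so its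
law on path space is `P^μ` (`lawOf_eq_map`). Hence the paths avoiding `N` have full `P^μ`-outer
measure for every `μ` with `μ(N) = 0`, contrary to hypothesis.

The delicate point is that `t ↦ P_t(x, N)` is not known to be measurable in advance;
`ae_kernel_eq_zero` deals with this. -/

/-! ### Right continuous functions and uniqueness of Laplace transforms. -/

theorem IsRightContinuous.measurable {Y : Type*} [TopologicalSpace Y]
    [TopologicalSpace.PseudoMetrizableSpace Y] [MeasurableSpace Y] [BorelSpace Y] {f : ℝ≥0 → Y}
    (hf : IsRightContinuous f) : Measurable f := by
  -- Grid points of mesh `1/(n+1)` just to the right of `t`: along them `f` becomes a countably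
  -- valued measurable function of `t`, converging pointwise to `f`.
  have happ : ∀ t : ℝ≥0, Tendsto (fun n : ℕ => ((⌊(n + 1 : ℝ≥0) * t⌋₊ + 1 : ℕ) : ℝ≥0) / (n + 1))
      atTop (𝓝[≥] t) := by
    intro t
    have hlo : ∀ n : ℕ, t ≤ ((⌊(n + 1 : ℝ≥0) * t⌋₊ + 1 : ℕ) : ℝ≥0) / (n + 1) := fun n => by
      rw [le_div_iff₀ (by positivity), mul_comm]
      exact_mod_cast (Nat.lt_floor_add_one _).le
    refine tendsto_nhdsWithin_iff.2 ⟨?_, Eventually.of_forall hlo⟩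
    refine tendsto_of_tendsto_of_tendsto_of_le_of_le tendsto_const_nhds
      (h := fun n : ℕ => t + 1 / ((n : ℝ≥0) + 1)) ?_ hlo fun n => ?_
    · simpa using tendsto_const_nhds.add (tendsto_one_div_add_atTop_nhds_zero_nat (𝕜 := ℝ≥0))
    · change _ ≤ t + 1 / ((n : ℝ≥0) + 1)
      rw [div_le_iff₀ (by positivity), add_mul t, one_div,
        inv_mul_cancel₀ (by positivity : (n : ℝ≥0) + 1 ≠ 0)]
      push_cast
      gcongr
      rw [mul_comm t]
      exact Nat.floor_le (by positivity)
  refine measurable_of_tendsto_metrizable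
    (f := fun (n : ℕ) t => f (((⌊(n + 1 : ℝ≥0) * t⌋₊ + 1 : ℕ) : ℝ≥0) / (n + 1))) (fun n => ?_)
    (tendsto_pi_nhds.2 fun t => (hf t).tendsto.comp (happ t))
  exact (measurable_from_nat (f := fun k : ℕ => f (((k + 1 : ℕ) : ℝ≥0) / (n + 1)))).comp
    (Nat.measurable_floor.comp (measurable_const_mul _))

/-- Lebesgue measure on `[0, ∞)`. -/
noncomputable def halfLineMeasure : Measure ℝ≥0 :=
  (volume.restrict (Ioi (0 : ℝ))).map Real.toNNReal

theorem lintegral_halfLineMeasure {f : ℝ≥0 → ℝ≥0∞} (hf : AEMeasurable f halfLineMeasure) :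
    ∫⁻ t, f t ∂halfLineMeasure = ∫⁻ t in Ioi (0 : ℝ), f t.toNNReal :=
  lintegral_map' hf measurable_real_toNNReal.aemeasurable

theorem halfLineMeasure_Ioo_pos {a b : ℝ≥0} (h : a < b) : 0 < halfLineMeasure (Ioo a b) := by
  rw [halfLineMeasure, Measure.map_apply measurable_real_toNNReal measurableSet_Ioo]
  have : (Ioo (a : ℝ) b) ⊆ Real.toNNReal ⁻¹' Ioo a b := fun t ht => by
    have h0 : 0 ≤ t := a.2.trans ht.1.le
    exact ⟨by rw [← NNReal.coe_lt_coe, Real.coe_toNNReal t h0]; exact ht.1,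
      by rw [← NNReal.coe_lt_coe, Real.coe_toNNReal t h0]; exact ht.2⟩
  refine lt_of_lt_of_le ?_ (measure_mono this)
  rw [Measure.restrict_apply measurableSet_Ioo,
    inter_eq_left.2 (fun t ht => mem_Ioi.2 (lt_of_le_of_lt a.2 ht.1)), Real.volume_Ioo]
  simpa using h

/-- Intervals have positive measure, so points of agreement accumulate at every `t` from the right.
-/
theorem IsRightContinuous.eq_of_ae_eq {Y : Type*} [TopologicalSpace Y] [T2Space Y] {f g : ℝ≥0 → Y}
    (hf : IsRightContinuous f) (hg : IsRightContinuous g) (h : f =ᵐ[halfLineMeasure] g) :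
    f = g := by
  funext t
  have hfreq : ∃ᶠ s in 𝓝[>] t, f s = g s := by
    rw [frequently_iff]
    intro U hU
    obtain ⟨b, hb, hbU⟩ := mem_nhdsGT_iff_exists_Ioo_subset.1 hU
    by_contra! hne
    exact (halfLineMeasure_Ioo_pos hb).ne'
      (measure_mono_null (fun s hs => hne s (hbU hs)) h)
  have := frequently_iff_neBot.1 hfreq
  have h1 : Tendsto f (𝓝[>] t ⊓ 𝓟 {s | f s = g s}) (𝓝 (f t)) :=
    (hf t).tendsto.mono_left (inf_le_left.trans (nhdsWithin_mono t Ioi_subset_Ici_self))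
  have h2 : Tendsto g (𝓝[>] t ⊓ 𝓟 {s | f s = g s}) (𝓝 (g t)) :=
    (hg t).tendsto.mono_left (inf_le_left.trans (nhdsWithin_mono t Ioi_subset_Ici_self))
  refine tendsto_nhds_unique h1 (h2.congr' ?_)
  filter_upwards [mem_inf_of_right (mem_principal_self _)] with s hs using hs.symm

/-- The finite measures with densities `e^{-t} p` and `e^{-t} q` give `e^{-nt}` the same integral,
namely the transform at `α = n + 1`. Polynomials in `e^{-t}` separate points, so by
Stone–Weierstrass the measures coincide, hence so do their densities almost everywhere. -/
theorem ae_eq_of_laplace_eq {p q : ℝ≥0 → ℝ≥0∞} (hp : Measurable p) (hq : Measurable q) {C : ℝ≥0}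
    (hpC : ∀ t, p t ≤ C) (hqC : ∀ t, q t ≤ C)
    (h : ∀ α : ℝ, 0 < α → ∫⁻ t, ENNReal.ofReal (Real.exp (-α * t)) * p t ∂halfLineMeasure =
      ∫⁻ t, ENNReal.ofReal (Real.exp (-α * t)) * q t ∂halfLineMeasure) :
    p =ᵐ[halfLineMeasure] q := by
  have hem : ∀ α : ℝ, Measurable fun t : ℝ≥0 => ENNReal.ofReal (Real.exp (-α * t)) := fun α => by
    fun_prop
  have hfin : ∀ r : ℝ≥0 → ℝ≥0∞, (∀ t, r t ≤ C) → ∀ α : ℝ, 0 < α →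
      ∫⁻ t, ENNReal.ofReal (Real.exp (-α * t)) * r t ∂halfLineMeasure ≠ ∞ := by
    intro r hr α hα
    refine ne_top_of_le_ne_top ?_ (lintegral_mono fun t => mul_le_mul_right (hr t) _)
    rw [lintegral_mul_const _ (hem α)]
    refine ENNReal.mul_ne_top ?_ ENNReal.coe_ne_top
    rw [lintegral_halfLineMeasure (hem α).aemeasurable,
      setLIntegral_congr_fun (g := fun t => ENNReal.ofReal (Real.exp (-α * t))) measurableSet_Ioi
        (fun t ht => by simp only [Real.coe_toNNReal t (le_of_lt ht)])]
    exact ((integrableOn_exp_mul_Ioi (neg_lt_zero.2 hα) 0).lintegral_lt_top).ne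
  set μ := halfLineMeasure.withDensity fun t => ENNReal.ofReal (Real.exp (-1 * t)) * p t with hμ
  set ν := halfLineMeasure.withDensity fun t => ENNReal.ofReal (Real.exp (-1 * t)) * q t with hν
  have : IsFiniteMeasure μ := isFiniteMeasure_withDensity (hfin p hpC 1 one_pos)
  have : IsFiniteMeasure ν := isFiniteMeasure_withDensity (hfin q hqC 1 one_pos)
  let e : ℝ≥0 →ᵇ ℝ := BoundedContinuousFunction.ofNormedAddCommGroup
    (fun t : ℝ≥0 => Real.exp (-t)) (by fun_prop) 1 fun t => by
      rw [Real.norm_eq_abs, abs_of_pos (Real.exp_pos _)]; simp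
  have hstar : ∀ a : ℝ≥0 →ᵇ ℝ, star a = a := fun a =>
    BoundedContinuousFunction.ext fun t => star_trivial (a t)
  let A : StarSubalgebra ℝ (ℝ≥0 →ᵇ ℝ) :=
    { Algebra.adjoin ℝ {e} with star_mem' := fun {a} ha => (hstar a).symm ▸ ha }
  have hμν : μ = ν := by
    refine ext_of_forall_mem_subalgebra_integral_eq_of_pseudoEMetric_complete_countable (𝕜 := ℝ)
      (A := A) ?_ ?_
    · intro x y hxy
      refine ⟨e, ⟨e.toContinuousMap, ⟨e, Algebra.subset_adjoin rfl, rfl⟩, rfl⟩, ?_⟩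
      simpa [e] using hxy
    · intro g hg
      have hint : ∀ (f : ℝ≥0 →ᵇ ℝ) (m : Measure ℝ≥0) [IsFiniteMeasure m], Integrable f m :=
        fun f m _ => f.integrable m
      have hpow : ∀ n : ℕ, ∫ t, (e ^ n) t ∂μ = ∫ t, (e ^ n) t ∂ν := by
        intro n
        have hval : ∀ t, (e ^ n) t = Real.exp (-(n : ℝ) * t) := fun t => by
          simp [e, ← Real.exp_nat_mul]
        have hmom : ∀ r : ℝ≥0 → ℝ≥0∞, Measurable r →
            ∫ t, (e ^ n) t ∂(halfLineMeasure.withDensity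
              fun t => ENNReal.ofReal (Real.exp (-1 * t)) * r t) =
            (∫⁻ t, ENNReal.ofReal (Real.exp (-(n + 1 : ℝ) * t)) * r t ∂halfLineMeasure).toReal := by
          intro r hr
          simp only [hval]
          rw [integral_eq_lintegral_of_nonneg_ae
            (Eventually.of_forall fun t => (Real.exp_pos _).le) (by fun_prop),
            lintegral_withDensity_eq_lintegral_mul _
              (f := fun t : ℝ≥0 => ENNReal.ofReal (Real.exp (-1 * t)) * r t)
              ((hem 1).mul hr) (hem n)]
          congr 1
          refine lintegral_congr fun t => ?_
          simp only [Pi.mul_apply]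
          rw [mul_right_comm, ← ENNReal.ofReal_mul (Real.exp_pos _).le, ← Real.exp_add]
          congr 3
          ring
        rw [hμ, hν, hmom p hp, hmom q hq, h _ (by positivity)]
      change g ∈ Algebra.adjoin ℝ {e} at hg
      rw [Algebra.adjoin_singleton_eq_range_aeval] at hg
      obtain ⟨r, rfl⟩ := hg
      change ∫ t, (Polynomial.aeval e r) t ∂μ = ∫ t, (Polynomial.aeval e r) t ∂ν
      induction r using Polynomial.induction_on' with
      | add r s hr hs =>
        simp only [map_add, BoundedContinuousFunction.add_apply]
        rw [integral_add (hint _ _) (hint _ _), integral_add (hint _ _) (hint _ _), hr, hs]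
      | monomial n a =>
        simp only [Polynomial.aeval_monomial, ← Algebra.smul_def,
          BoundedContinuousFunction.smul_apply, smul_eq_mul, integral_const_mul, hpow]
  have := (withDensity_eq_iff ((hem 1).mul hp).aemeasurable
    ((hem 1).mul hq).aemeasurable (hfin p hpC 1 one_pos)).1 hμν
  filter_upwards [this] with t ht
  exact (ENNReal.mul_right_inj (by simpa using Real.exp_pos _) ENNReal.ofReal_ne_top).1 ht

/-! ### Universally measurable sets and measures on them. -/

theorem Continuous.measurable_univBorel {E F : Type*} [TopologicalSpace E] [TopologicalSpace F]
    {f : E → F} (hf : Continuous f) : @Measurable E F (univBorel E) (univBorel F) f := by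
  intro s hs μ hμ
  let := borel E
  let := borel F
  have : BorelSpace E := ⟨rfl⟩
  have : BorelSpace F := ⟨rfl⟩
  have : NullMeasurableSet s (μ.map f) := hs (μ.map f) inferInstance
  exact this.preimage ⟨hf.measurable, Measure.AbsolutelyContinuous.rfl⟩

theorem opensMeasurableSpace_univBorel (E : Type*) [TopologicalSpace E] :
    @OpensMeasurableSpace E _ (univBorel E) :=
  @OpensMeasurableSpace.mk E _ (univBorel E) borel_le_univBorel

theorem univBorel_subtype {E : Type u} [TopologicalSpace E] {S : Set E}
    (hS : MeasurableSet[univBorel E] S) :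
    univBorel S = (univBorel E).comap Subtype.val := by
  apply le_antisymm
  · intro A hA
    refine ⟨Subtype.val '' A, fun ν hν => ?_, preimage_image_eq _ Subtype.val_injective⟩
    let := borel E
    have hb : borel S = Subtype.instMeasurableSpace := borel_comap
    change ∀ μ : @Measure S (borel S), _ → _ at hA
    rw [hb] at hA
    have hfin : IsFiniteMeasure (ν.comap (Subtype.val : S → E)) := by
      refine ⟨?_⟩
      rw [Measure.comap_apply₀ _ _ Subtype.val_injective
        (fun _ => Measure.MeasurableSet.nullMeasurableSet_subtype_coe (hS ν hν)) nullMeasurableSet_univ]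
      exact measure_lt_top _ _
    exact Measure.NullMeasurableSet.subtype_coe (hS ν hν) (hA (ν.comap _) hfin)
  · rintro _ ⟨B, hB, rfl⟩
    exact continuous_subtype_val.measurable_univBorel hB

/-- A universally measurable set differs from some Borel set by a null set of the common Borel
trace. -/
theorem ext_of_trim_borel_eq {E : Type*} [TopologicalSpace E] {μ ν : @Measure E (univBorel E)}
    [hμ : @IsFiniteMeasure E (univBorel E) μ]
    (h : μ.trim borel_le_univBorel = ν.trim borel_le_univBorel) : μ = ν := by
  let := univBorel E
  refine Measure.ext fun A hA => ?_
  have hfin := isFiniteMeasure_trim (μ := μ) (borel_le_univBorel (E := E))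
  obtain ⟨B, hB, hAB⟩ := hA (μ.trim borel_le_univBorel) hfin
  have h1 : A =ᵐ[μ] B := ae_eq_of_ae_eq_trim hAB
  have h2 : A =ᵐ[ν] B := ae_eq_of_ae_eq_trim (h ▸ hAB)
  rw [measure_congr h1, measure_congr h2, ← trim_measurableSet_eq borel_le_univBorel hB, h,
    trim_measurableSet_eq borel_le_univBorel hB]

theorem ext_univBorel_of_forall_lintegral_eq {E : Type*} [TopologicalSpace E]
    [HasOuterApproxClosed E] {μ ν : @Measure E (univBorel E)}
    [hμ : @IsFiniteMeasure E (univBorel E) μ]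
    (h : ∀ g : E →ᵇ ℝ≥0, ∫⁻ x, g x ∂μ = ∫⁻ x, g x ∂ν) : μ = ν := by
  refine ext_of_trim_borel_eq ?_
  have hfin := @isFiniteMeasure_trim E (borel E) (univBorel E) μ borel_le_univBorel hμ
  let := borel E
  have : BorelSpace E := ⟨rfl⟩
  refine ext_of_forall_lintegral_eq_of_IsFiniteMeasure fun g => ?_
  have hg : Measurable fun x => (g x : ℝ≥0∞) := by fun_prop
  rw [lintegral_trim _ hg, lintegral_trim _ hg, h]

theorem IsRadonSpace.pseudoMetrizableSpace {E : Type u} [TopologicalSpace E]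
    (hE : IsRadonSpace E) : TopologicalSpace.PseudoMetrizableSpace E := by
  obtain ⟨K, _, _, i, hi, -⟩ := hE
  exact hi.isInducing.pseudoMetrizableSpace

/-! ### The Markov property without conditional expectations. -/

namespace IsMarkovProcess

variable {E : Type u} [TopologicalSpace E] {P : MarkovTransitionFunction E} {Ω : Type u}
  {mΩ : MeasurableSpace Ω} {Pr : Measure Ω} {𝓖 : Filtration ℝ≥0 mΩ} {X : ℝ≥0 → Ω → E}

theorem measurable (hX : IsMarkovProcess P Pr 𝓖 X) (t : ℝ≥0) :
    @Measurable Ω E mΩ (univBorel E) (X t) :=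
  (hX.adapted t).mono (𝓖.le t) le_rfl

theorem measure_inter_preimage [IsProbabilityMeasure Pr] (hX : IsMarkovProcess P Pr 𝓖 X)
    (t s : ℝ≥0) {A : Set Ω} (hA : MeasurableSet[𝓖 t] A) {B : Set E}
    (hB : MeasurableSet[univBorel E] B) :
    Pr (A ∩ X (t + s) ⁻¹' B) = ∫⁻ ω in A, P.kernel s (X t ω) B ∂Pr := by
  let := univBorel E
  have := P.markov s
  have hA' := 𝓖.le t _ hA
  have hXB : MeasurableSet (X (t + s) ⁻¹' B) := hX.measurable _ hB
  have hmk : Measurable fun ω => P.kernel s (X t ω) B :=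
    ((P.kernel s).measurable_coe hB).comp (hX.measurable t)
  have hind : ∀ ω, B.indicator (1 : E → ℝ) (X (t + s) ω) =
      (X (t + s) ⁻¹' B).indicator (1 : Ω → ℝ) ω := fun ω => rfl
  have h1 := hX.markov_property t s (B.indicator 1) (measurable_one.indicator hB)
    ⟨1, fun x => by by_cases hx : x ∈ B <;> simp [hx]⟩
  simp only [hind, integral_indicator_one hB] at h1
  have key := setIntegral_condExp (μ := Pr) (𝓖.le t)
    ((integrable_const (1 : ℝ)).indicator hXB) hA
  change ∫ ω in A, condExp (𝓖 t) Pr (fun ω => (X (t + s) ⁻¹' B).indicator 1 ω) ω ∂Pr = _ at key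
  rw [setIntegral_congr_ae hA' (h1.mono fun ω h _ => h)] at key
  have h2 : ∫ ω in A, (P.kernel s (X t ω)).real B ∂Pr =
      (∫⁻ ω in A, P.kernel s (X t ω) B ∂Pr).toReal :=
    integral_toReal hmk.aemeasurable (Eventually.of_forall fun ω => measure_lt_top _ _)
  have h3 : ∫ ω in A, (X (t + s) ⁻¹' B).indicator (fun _ => (1 : ℝ)) ω ∂Pr =
      (Pr (A ∩ X (t + s) ⁻¹' B)).toReal := by
    rw [← Pi.one_def, integral_indicator_one hXB, measureReal_restrict_apply hXB, inter_comm]; rfl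
  rw [h2, h3] at key
  refine ((ENNReal.toReal_eq_toReal_iff' ?_ (measure_ne_top _ _)).1 key).symm
  refine ne_top_of_le_ne_top (measure_ne_top Pr A) ?_
  calc ∫⁻ ω in A, P.kernel s (X t ω) B ∂Pr ≤ ∫⁻ _ in A, 1 ∂Pr :=
        lintegral_mono fun ω => prob_le_one
    _ = Pr A := by simp

theorem map_restrict_eq_bind [IsProbabilityMeasure Pr] (hX : IsMarkovProcess P Pr 𝓖 X)
    (t s : ℝ≥0) {A : Set Ω} (hA : MeasurableSet[𝓖 t] A) :
    @Measure.map Ω E mΩ (univBorel E) (X (t + s)) (Pr.restrict A) =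
      @Measure.bind E E (univBorel E) (univBorel E)
        (@Measure.map Ω E mΩ (univBorel E) (X t) (Pr.restrict A)) (P.kernel s) := by
  let := univBorel E
  refine Measure.ext fun B hB => ?_
  rw [Measure.map_apply (hX.measurable _) hB, Measure.restrict_apply (hX.measurable _ hB),
    inter_comm, hX.measure_inter_preimage t s hA hB, Measure.bind_apply hB (P.kernel s).aemeasurable,
    lintegral_map ((P.kernel s).measurable_coe hB) (hX.measurable t)]

theorem setLIntegral_comp [IsProbabilityMeasure Pr] (hX : IsMarkovProcess P Pr 𝓖 X)
    (t s : ℝ≥0) {A : Set Ω} (hA : MeasurableSet[𝓖 t] A) {f : E → ℝ≥0∞}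
    (hf : @Measurable E ℝ≥0∞ (univBorel E) _ f) :
    ∫⁻ ω in A, f (X (t + s) ω) ∂Pr = ∫⁻ ω in A, ∫⁻ y, f y ∂(P.kernel s (X t ω)) ∂Pr := by
  let := univBorel E
  rw [← lintegral_map hf (hX.measurable _), hX.map_restrict_eq_bind t s hA,
    Measure.lintegral_bind (P.kernel s).aemeasurable hf.aemeasurable,
    lintegral_map hf.lintegral_kernel (hX.measurable t)]

theorem map_eq_kernel [IsProbabilityMeasure Pr] (hX : IsMarkovProcess P Pr 𝓖 X) {x : E}
    (h0 : @Measure.map Ω E mΩ (univBorel E) (X 0) Pr = @Measure.dirac E (univBorel E) x)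
    (t : ℝ≥0) : @Measure.map Ω E mΩ (univBorel E) (X t) Pr = P.kernel t x := by
  let := univBorel E
  have := hX.map_restrict_eq_bind 0 t MeasurableSet.univ
  rw [Measure.restrict_univ, zero_add, h0] at this
  rw [this, Measure.dirac_bind (P.kernel t).measurable]

end IsMarkovProcess

instance : SFinite halfLineMeasure := by
  unfold halfLineMeasure
  infer_instance

/-! ### Regularity in time and identification of the kernels off `N`. -/

namespace MarkovTransitionFunction

variable {E : Type u} [TopologicalSpace E] {P : MarkovTransitionFunction E}

/-- The integral is the expectation of `g (X t)` for a right continuous process started at `x`;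
dominated convergence applies. -/
theorem HD1.isRightContinuous_lintegral (hP : P.HD1) (x : E) (g : E →ᵇ ℝ≥0) :
    IsRightContinuous fun t => ∫⁻ y, g y ∂(P.kernel t x) := by
  obtain ⟨Ω, mΩ, Pr, 𝓖, X, hPr, hr, hX, h0⟩ := hP (@Measure.dirac E (univBorel E) x)
    (@Measure.dirac.isProbabilityMeasure E (univBorel E) x)
  let := univBorel E
  have := opensMeasurableSpace_univBorel E
  have hg : Measurable fun y => (g y : ℝ≥0∞) := by fun_prop
  have heq : ∀ t, ∫⁻ y, g y ∂(P.kernel t x) = ∫⁻ ω, g (X t ω) ∂Pr := fun t => by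
    rw [← hX.map_eq_kernel h0 t, lintegral_map hg (hX.measurable t)]
  simp only [heq]
  intro t
  refine tendsto_lintegral_filter_of_dominated_convergence (fun _ => (nndist g 0 : ℝ≥0∞))
    (Eventually.of_forall fun s => hg.comp (hX.measurable s))
    (Eventually.of_forall fun s => Eventually.of_forall fun ω =>
      ENNReal.coe_le_coe.2 (BoundedContinuousFunction.NNReal.upper_bound g _))
    (by simp) (Eventually.of_forall fun ω => ?_)
  exact (ENNReal.continuous_coe.comp g.continuous).continuousAt.tendsto.comp (hr ω t)

theorem isProbabilityMeasure_trim_kernel (t : ℝ≥0) (x : E) :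
    @IsProbabilityMeasure E (borel E) ((P.kernel t x).trim borel_le_univBorel) := by
  have := (P.markov t).isProbabilityMeasure x
  refine @IsProbabilityMeasure.mk E (borel E) _ ?_
  rw [trim_measurableSet_eq _ (@MeasurableSet.univ E (borel E))]
  exact @measure_univ E (univBorel E) _ _

theorem HD1.measurable_trim [HasOuterApproxClosed E] (hP : P.HD1) (x : E) :
    @Measurable ℝ≥0 (@Measure E (borel E)) _ (@Measure.instMeasurableSpace E (borel E))
      fun t => (P.kernel t x).trim borel_le_univBorel := by
  let := borel E
  have : BorelSpace E := ⟨rfl⟩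
  have hprob : ∀ t, IsProbabilityMeasure ((P.kernel t x).trim borel_le_univBorel) := fun t =>
    isProbabilityMeasure_trim_kernel t x
  refine Measurable.measure_of_isPiSystem_of_isProbabilityMeasure borel_eq_generateFrom_isClosed
    isPiSystem_isClosed fun F hF => ?_
  have hF' : IsClosed F := hF
  refine measurable_of_tendsto_metrizable
    (f := fun n t => ∫⁻ y, hF'.apprSeq n y ∂((P.kernel t x).trim borel_le_univBorel))
    (fun n => ?_) (tendsto_pi_nhds.2 fun t => HasOuterApproxClosed.tendsto_lintegral_apprSeq hF' _)
  simp only [lintegral_trim borel_le_univBorel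
    (show Measurable fun y => (hF'.apprSeq n y : ℝ≥0∞) by fun_prop)]
  exact (hP.isRightContinuous_lintegral x _).measurable

/-- Without measurability in `t`, a vanishing `lintegral` need not force the integrand to vanish
almost everywhere. Mix the Borel traces of `P_t(x, ·)` over a finite measure with the null sets of
Lebesgue measure, and choose a Borel `B ⊆ N` filling `N` up to a null set of the mixture. For `B`
the integrand is measurable, so the mixture kills `B`, hence `N`. -/
theorem IsWeaklyNegligible.ae_kernel_eq_zero [HasOuterApproxClosed E] (hP : P.HD1) {N : Set E}
    (hN : P.IsWeaklyNegligible N) {x : E} (hx : x ∉ N) :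
    ∀ᵐ t ∂halfLineMeasure, P.kernel t x N = 0 := by
  obtain ⟨hNm, α, -, hα⟩ := hN
  have hκ := hP.measurable_trim x
  let := borel E
  set κ : ℝ≥0 → Measure E := fun t => (P.kernel t x).trim borel_le_univBorel with hκdef
  have hprob : ∀ t, IsProbabilityMeasure (κ t) := fun t =>
    isProbabilityMeasure_trim_kernel t x
  set m := halfLineMeasure.toFinite.bind κ with hm
  have hmfin : IsFiniteMeasure m := by
    refine ⟨?_⟩
    rw [hm, Measure.bind_apply MeasurableSet.univ hκ.aemeasurable]
    simp
  obtain ⟨B, hBN, hB, hBeq⟩ := (hNm m hmfin).exists_measurable_subset_ae_eq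
  have hBmeas : Measurable fun t => κ t B := (Measure.measurable_coe hB).comp hκ
  have hκB : ∀ t, κ t B = P.kernel t x B := fun t => trim_measurableSet_eq _ hB
  have hint : ∫⁻ t : ℝ≥0, ENNReal.ofReal (Real.exp (-α * t)) * κ t B ∂halfLineMeasure = 0 := by
    rw [lintegral_halfLineMeasure (by fun_prop), ← nonpos_iff_eq_zero, ← hα x hx]
    refine setLIntegral_mono' measurableSet_Ioi fun t ht => ?_
    rw [Real.coe_toNNReal t (le_of_lt ht), hκB]
    gcongr
    rw [@lintegral_indicator_const E (univBorel E) _ _ hNm 1, one_mul]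
    exact measure_mono hBN
  have hB0 : ∀ᵐ t ∂halfLineMeasure, κ t B = 0 := by
    filter_upwards [(lintegral_eq_zero_iff (by fun_prop)).1 hint] with t ht
    exact (mul_eq_zero.1 ht).resolve_left (by simpa using Real.exp_pos _)
  have hmN : m N = 0 := by
    rw [← measure_congr hBeq, hm, Measure.bind_apply hB hκ.aemeasurable, lintegral_eq_zero_iff hBmeas]
    rwa [EventuallyEq, ae_toFinite]
  -- A Borel hull of `N` carries nullity from the mixture to almost every `P_t(x, ·)`, whose Borel
  -- trace only sees Borel sets exactly.
  have hcov : ∀ᵐ y ∂m, y ∉ toMeasurable m N :=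
    measure_eq_zero_iff_ae_notMem.1 ((measure_toMeasurable N).trans hmN)
  have := Measure.ae_ae_of_ae_bind hκ.aemeasurable hcov
  rw [ae_toFinite] at this
  filter_upwards [this] with t ht
  have h1 : κ t (toMeasurable m N) = 0 := by simpa using measure_eq_zero_iff_ae_notMem.2 ht
  rw [trim_measurableSet_eq _ (measurableSet_toMeasurable _ _)] at h1
  exact measure_mono_null (subset_toMeasurable _ _) h1

theorem resolvent_eq_lintegral_halfLineMeasure {α : ℝ} {f : E → ℝ≥0∞} {x : E}
    (hf : Measurable fun t => ∫⁻ y, f y ∂(P.kernel t x)) :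
    P.resolvent α f x =
      ∫⁻ t : ℝ≥0, ENNReal.ofReal (Real.exp (-α * t)) * ∫⁻ y, f y ∂(P.kernel t x)
        ∂halfLineMeasure := by
  rw [lintegral_halfLineMeasure (by fun_prop), resolvent]
  refine setLIntegral_congr_fun measurableSet_Ioi fun t ht => ?_
  simp only [Real.coe_toNNReal t (le_of_lt ht)]

theorem lintegral_extend_eq {N : Set E} {μ : @Measure E (univBorel E)} (hμ : μ N = 0)
    (g : E → ℝ≥0∞) :
    ∫⁻ y, Function.extend (Subtype.val : (Nᶜ : Set E) → E) (fun y => g y) 0 y ∂μ =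
      ∫⁻ y, g y ∂μ := by
  let := univBorel E
  refine lintegral_congr_ae ?_
  filter_upwards [measure_eq_zero_iff_ae_notMem.1 hμ] with y hy
  exact Subtype.val_injective.extend_apply (fun y : (Nᶜ : Set E) => g y) 0 ⟨y, hy⟩

theorem IsWeaklyNegligible.restrictedResolvent_eq [HasOuterApproxClosed E] (hP : P.HD1) {N : Set E}
    (hN : P.IsWeaklyNegligible N) (α : ℝ) (g : E → ℝ≥0∞) (x : (Nᶜ : Set E)) :
    P.restrictedResolvent N α (fun y => g y) x = P.resolvent α g x := by
  refine lintegral_congr_ae ?_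
  filter_upwards [ae_of_ae_map measurable_real_toNNReal.aemeasurable
    (hN.ae_kernel_eq_zero hP x.2)] with t ht
  rw [lintegral_extend_eq ht]

theorem map_val_kernel_eq (hE : IsRadonSpace E) (hP : P.HD1) {N : Set E}
    (hN : P.IsWeaklyNegligible N) {Q : MarkovTransitionFunction (Nᶜ : Set E)} (hQ : Q.HD1)
    (hPQ : ∀ α : ℝ, 0 < α → ∀ f : (Nᶜ : Set E) → ℝ≥0∞,
      @Measurable (Nᶜ : Set E) ℝ≥0∞ (univBorel (Nᶜ : Set E)) _ f →
      ∀ x : (Nᶜ : Set E), Q.resolvent α f x = P.restrictedResolvent N α f x)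
    (t : ℝ≥0) (x : (Nᶜ : Set E)) :
    @Measure.map (Nᶜ : Set E) E (univBorel (Nᶜ : Set E)) (univBorel E) Subtype.val (Q.kernel t x) =
      P.kernel t x := by
  have := hE.pseudoMetrizableSpace
  have hval := (continuous_subtype_val (p := (· ∈ Nᶜ))).measurable_univBorel
  have := (P.markov t).isProbabilityMeasure x
  have := (Q.markov t).isProbabilityMeasure x
  symm
  refine ext_univBorel_of_forall_lintegral_eq fun g => ?_
  have hg : @Measurable E ℝ≥0∞ (univBorel E) _ fun y => (g y : ℝ≥0∞) := by
    have := opensMeasurableSpace_univBorel E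
    let := univBorel E
    fun_prop
  rw [@lintegral_map _ _ (univBorel (Nᶜ : Set E)) (univBorel E) _ _ _ hg hval]
  let g' : (Nᶜ : Set E) →ᵇ ℝ≥0 := g.compContinuous ⟨Subtype.val, continuous_subtype_val⟩
  have hg' : nndist g' 0 ≤ nndist g 0 := by
    rw [← NNReal.coe_le_coe, coe_nndist, coe_nndist]
    exact (BoundedContinuousFunction.dist_le dist_nonneg).2 fun y =>
      BoundedContinuousFunction.dist_coe_le_dist (f := g) (g := 0) (y : E)
  have hp := hP.isRightContinuous_lintegral x g
  have hq := hQ.isRightContinuous_lintegral x g'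
  -- The restriction of `g` has no larger sup norm, so `nndist g 0` bounds both functions of time.
  refine congrFun (hp.eq_of_ae_eq hq (ae_eq_of_laplace_eq hp.measurable hq.measurable
    (C := nndist g 0) (fun s => ?_) (fun s => ?_) fun α hα => ?_)) t
  · have := (P.markov s).isProbabilityMeasure x
    refine (lintegral_mono fun y =>
      ENNReal.coe_le_coe.2 (BoundedContinuousFunction.NNReal.upper_bound g y)).trans ?_
    simp
  · have := (Q.markov s).isProbabilityMeasure x
    refine (lintegral_mono (g := fun _ => (nndist g' 0 : ℝ≥0∞)) fun y =>
      ENNReal.coe_le_coe.2 (BoundedContinuousFunction.NNReal.upper_bound g' y)).trans ?_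
    rw [lintegral_const, measure_univ, mul_one]
    exact ENNReal.coe_le_coe.2 hg'
  · rw [← resolvent_eq_lintegral_halfLineMeasure hp.measurable,
      ← resolvent_eq_lintegral_halfLineMeasure hq.measurable, 
      hPQ α hα (fun y => (g' y : ℝ≥0∞)) (hg.comp hval) x]
    exact (hN.restrictedResolvent_eq hP α (fun y => (g y : ℝ≥0∞)) x).symm

theorem isMarkovProcess_of_map_val_kernel_eq {S : Set E} {Q : MarkovTransitionFunction S}
    (h : ∀ (t : ℝ≥0) (x : S),
      @Measure.map S E (univBorel S) (univBorel E) Subtype.val (Q.kernel t x) = P.kernel t x)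
    {Ω : Type u} {mΩ : MeasurableSpace Ω} {Pr : Measure Ω} {𝓖 : Filtration ℝ≥0 mΩ}
    {Y : ℝ≥0 → Ω → S} (hY : IsMarkovProcess Q Pr 𝓖 Y) :
    IsMarkovProcess P Pr 𝓖 fun t ω => (Y t ω : E) := by
  have hval := (continuous_subtype_val (p := (· ∈ S))).measurable_univBorel
  refine ⟨fun t => hval.comp (hY.adapted t), fun t s f hf ⟨C, hC⟩ => ?_⟩
  refine (hY.markov_property t s (fun y => f y) (hf.comp hval) ⟨C, fun y => hC y⟩).trans
    (Eventually.of_forall fun ω => ?_)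
  simp only
  rw [← h]
  let := univBorel E
  exact (@integral_map _ _ _ _ (univBorel S) _ _ (univBorel E) _ hval.aemeasurable _
    hf.aestronglyMeasurable).symm

end MarkovTransitionFunction

/-! ### Restriction of initial laws, and uniqueness of the law on path space. -/

theorem exists_map_val_eq {E : Type u} [TopologicalSpace E] {S : Set E}
    (hS : MeasurableSet[univBorel E] S) (μ : @Measure E (univBorel E))
    (hμ : @IsProbabilityMeasure E (univBorel E) μ) (hμS : μ Sᶜ = 0) :
    ∃ ν : @Measure S (univBorel S), @IsProbabilityMeasure S (univBorel S) ν ∧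
      @Measure.map S E (univBorel S) (univBorel E) Subtype.val ν = μ := by
  rw [univBorel_subtype hS]
  let := univBorel E
  have hmap : (μ.comap (Subtype.val : S → E)).map Subtype.val = μ := by
    rw [map_comap_subtype_coe hS, Measure.restrict_eq_self_of_ae_mem (mem_ae_iff.2 hμS)]
  refine ⟨μ.comap Subtype.val, ⟨?_⟩, hmap⟩
  rw [comap_subtype_coe_apply hS, image_univ, Subtype.range_coe, prob_compl_eq_zero_iff hS |>.1 hμS]

variable {E : Type u} [TopologicalSpace E]

/-- `F` is chosen before the process, so it depends only on `P`, the times and the sets. Peeling off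
the earliest time `a` replaces the later density `F` by `P_{a-t}(1_{B a} F)`. -/
theorem exists_lintegral_eq_measure_iInter (P : MarkovTransitionFunction E) {B : ℝ≥0 → Set E}
    (S : Finset ℝ≥0) (hB : ∀ s ∈ S, MeasurableSet[univBorel E] (B s)) :
    ∀ t, (∀ s ∈ S, t ≤ s) → ∃ F : E → ℝ≥0∞, @Measurable E ℝ≥0∞ (univBorel E) _ F ∧
      ∀ (Ω : Type u) (mΩ : MeasurableSpace Ω) (Pr : Measure Ω) (𝓖 : Filtration ℝ≥0 mΩ)
        (X : ℝ≥0 → Ω → E), IsProbabilityMeasure Pr → IsMarkovProcess P Pr 𝓖 X →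
        ∀ A, MeasurableSet[𝓖 t] A →
          Pr (A ∩ ⋂ s ∈ S, X s ⁻¹' B s) = ∫⁻ ω in A, F (X t ω) ∂Pr := by
  let := univBorel E
  induction S using Finset.induction_on_min with
  | empty =>
    refine fun t _ => ⟨1, measurable_one, fun Ω mΩ Pr 𝓖 X _ hX A hA => ?_⟩
    simp
  | insert a S haS ih =>
    intro t ht
    obtain ⟨F, hF, hFX⟩ := ih (fun s hs => hB s (Finset.mem_insert_of_mem hs)) a
      fun s hs => (haS s hs).le
    have hBa := hB a (Finset.mem_insert_self a S)
    have hta : t + (a - t) = a := add_tsub_cancel_of_le (ht a (Finset.mem_insert_self a S))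
    have hFi : Measurable ((B a).indicator F) := hF.indicator hBa
    refine ⟨fun x => ∫⁻ y, (B a).indicator F y ∂(P.kernel (a - t) x), hFi.lintegral_kernel,
      fun Ω mΩ Pr 𝓖 X hPr hX A hA => ?_⟩
    have hXa : MeasurableSet[𝓖 a] (X a ⁻¹' B a) := hX.adapted a hBa
    have hA' : MeasurableSet[𝓖 a] (A ∩ X a ⁻¹' B a) :=
      (𝓖.mono (ht a (Finset.mem_insert_self a S)) _ hA).inter hXa
    rw [Finset.set_biInter_insert, ← inter_assoc, hFX Ω mΩ Pr 𝓖 X hPr hX _ hA',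
      ← hX.setLIntegral_comp t (a - t) hA hFi, hta, inter_comm,
      ← setLIntegral_indicator (𝓖.le a _ hXa)]
    rfl

namespace PathSpace

theorem instMeasurableSpace_eq_generateFrom :
    PathSpace.instMeasurableSpace (E := E) = .generateFrom
      (piiUnionInter (fun t => {s | MeasurableSet[(univBorel E).comap (coord t)] s}) univ) := by
  refine Eq.trans ?_ (generateFrom_piiUnionInter_measurableSet _ _).symm
  exact iSup_congr fun t =>
    (iSup_pos (f := fun _ => (univBorel E).comap (coord t)) (mem_univ t)).symm

theorem isPiSystem_cylinders : IsPiSystem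
    (piiUnionInter (fun t => {s | MeasurableSet[(univBorel E).comap (coord (E := E) t)] s}) univ) :=
  isPiSystem_piiUnionInter _ (fun t => @MeasurableSpace.isPiSystem_measurableSet _
    ((univBorel E).comap (coord t))) _

/-- The path map of a right continuous process. -/
def ofPaths {Ω : Type*} (X : ℝ≥0 → Ω → E) (hr : ∀ ω, IsRightContinuous fun t => X t ω) (ω : Ω) :
    PathSpace E :=
  ⟨fun t => X t ω, hr ω⟩

theorem measurable_ofPaths {Ω : Type*} [MeasurableSpace Ω] {X : ℝ≥0 → Ω → E}
    (hr : ∀ ω, IsRightContinuous fun t => X t ω)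
    (hX : ∀ t, @Measurable Ω E _ (univBorel E) (X t)) :
    Measurable (ofPaths X hr) := by
  rw [measurable_iff_comap_le]
  change MeasurableSpace.comap _ (⨆ t : ℝ≥0, (univBorel E).comap (coord t)) ≤ _
  simp only [MeasurableSpace.comap_iSup, MeasurableSpace.comap_comp]
  exact iSup_le fun s => (hX s).comap_le

end PathSpace

namespace CanonicalRealization

variable {P : MarkovTransitionFunction E}

theorem lintegral_coord_zero [T1Space E] (L : CanonicalRealization P) (x : E) (F : E → ℝ≥0∞) :
    ∫⁻ ω, F (PathSpace.coord 0 ω) ∂(L.law x) = F x := by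
  have := L.isProbabilityMeasure x
  have hae : ∀ᵐ ω ∂(L.law x), PathSpace.coord 0 ω = x := by
    let := univBorel E
    have := opensMeasurableSpace_univBorel E
    have hm : MeasurableSet {ω : PathSpace E | PathSpace.coord 0 ω = x} :=
      (CanonicalRealization.isMarkovProcess L x).measurable 0 (measurableSet_singleton x)
    exact mem_ae_iff.2 ((prob_compl_eq_zero_iff hm).2 (L.start x))
  rw [lintegral_congr_ae (g := fun _ => F x) (hae.mono fun ω h => by simp only [h])]
  simp

/-- One `F` serves the canonical laws and every other realization; this is what allows their laws to
be compared. -/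
theorem exists_density_of_mem_cylinders [T1Space E] (L : CanonicalRealization P)
    {C : Set (PathSpace E)}
    (hC : C ∈ piiUnionInter
      (fun t => {s | MeasurableSet[(univBorel E).comap (PathSpace.coord t)] s}) univ) :
    ∃ F : E → ℝ≥0∞, @Measurable E ℝ≥0∞ (univBorel E) _ F ∧ (∀ x, L.law x C = F x) ∧
      ∀ (Ω : Type u) (mΩ : MeasurableSpace Ω) (Pr : Measure Ω) (𝓖 : Filtration ℝ≥0 mΩ)
        (X : ℝ≥0 → Ω → E) (hr : ∀ ω, IsRightContinuous fun t => X t ω), IsProbabilityMeasure Pr →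
        IsMarkovProcess P Pr 𝓖 X →
        Pr ((PathSpace.ofPaths X hr) ⁻¹' C) = ∫⁻ ω, F (X 0 ω) ∂Pr := by
  obtain ⟨S, -, f, hf, rfl⟩ := hC
  choose! B hB hBf using hf
  obtain ⟨F, hF, hFX⟩ := exists_lintegral_eq_measure_iInter P S hB 0 fun s _ => zero_le
  refine ⟨F, hF, fun x => ?_, fun Ω mΩ Pr 𝓖 X hr hPr hX => ?_⟩
  · have h1 := hFX _ _ _ _ _ (L.isProbabilityMeasure x)
      (CanonicalRealization.isMarkovProcess L x) univ MeasurableSet.univ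
    rw [univ_inter, Measure.restrict_univ, L.lintegral_coord_zero] at h1
    rw [← h1]
    congr 1
    exact iInter₂_congr fun s hs => (hBf s hs).symm
  · have h1 := hFX Ω mΩ Pr 𝓖 X hPr hX univ MeasurableSet.univ
    rw [univ_inter, Measure.restrict_univ] at h1
    rw [← h1]
    congr 1
    refine preimage_iInter₂.trans ?_
    refine iInter₂_congr fun s hs => ?_
    rw [← hBf s hs]
    rfl

/-- Needed for the `bind` in `lawOf` to be the genuine mixture of the `P^x`. -/
theorem measurable_law [T1Space E] (L : CanonicalRealization P) :
    @Measurable E (Measure (PathSpace E)) (univBorel E) _ L.law := by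
  let := univBorel E
  have := L.isProbabilityMeasure
  refine Measurable.measure_of_isPiSystem_of_isProbabilityMeasure
    PathSpace.instMeasurableSpace_eq_generateFrom PathSpace.isPiSystem_cylinders fun C hC => ?_
  obtain ⟨F, hF, hFL, -⟩ := L.exists_density_of_mem_cylinders hC
  simpa only [hFL] using hF

theorem lawOf_eq_map [T1Space E] (L : CanonicalRealization P) {Ω : Type u} {mΩ : MeasurableSpace Ω}
    {Pr : Measure Ω} [IsProbabilityMeasure Pr] {𝓖 : Filtration ℝ≥0 mΩ} {X : ℝ≥0 → Ω → E}
    (hr : ∀ ω, IsRightContinuous fun t => X t ω) (hX : IsMarkovProcess P Pr 𝓖 X) :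
    L.lawOf (@Measure.map Ω E mΩ (univBorel E) (X 0) Pr) =
      Pr.map (PathSpace.ofPaths X hr) := by
  let := univBorel E
  have hΦ := PathSpace.measurable_ofPaths hr hX.measurable
  have hpr := Measure.isProbabilityMeasure_map (μ := Pr) hΦ.aemeasurable
  have heq : ∀ C ∈ piiUnionInter
      (fun t => {s | MeasurableSet[(univBorel E).comap (PathSpace.coord (E := E) t)] s}) univ,
      (Pr.map (PathSpace.ofPaths X hr)) C =
        L.lawOf (Pr.map (X 0)) C := fun C hC => by
    have hCm : MeasurableSet C := by
      rw [PathSpace.instMeasurableSpace_eq_generateFrom]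
      exact MeasurableSpace.measurableSet_generateFrom hC
    obtain ⟨F, hF, hFL, hFX⟩ := L.exists_density_of_mem_cylinders hC
    rw [Measure.map_apply hΦ hCm, hFX Ω mΩ Pr 𝓖 X hr inferInstance hX, lawOf,
      Measure.bind_apply hCm L.measurable_law.aemeasurable]
    simp only [hFL]
    rw [lintegral_map hF (hX.measurable 0)]
  refine (ext_of_generate_finite _ PathSpace.instMeasurableSpace_eq_generateFrom
    PathSpace.isPiSystem_cylinders heq (heq univ ?_)).symm
  -- The whole space is the cylinder with no times, which gives equal total masses.
  exact ⟨∅, by simp, fun _ => univ, by simp, by simp⟩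

end CanonicalRealization

/-! ### Full outer measure of the paths avoiding `N`. -/

theorem CanonicalRealization.lawOf_forall_notMem_eq_one {E : Type u} [TopologicalSpace E]
    (hE : IsRadonSpace E) {P : MarkovTransitionFunction E} (hP : P.HD1)
    (L : CanonicalRealization P) {N : Set E} (hN : P.IsWeaklyNegligible N)
    {Q : MarkovTransitionFunction (Nᶜ : Set E)} (hQ : Q.HD1)
    (hPQ : ∀ α : ℝ, 0 < α → ∀ f : (Nᶜ : Set E) → ℝ≥0∞,
      @Measurable (Nᶜ : Set E) ℝ≥0∞ (univBorel (Nᶜ : Set E)) _ f →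
      ∀ x : (Nᶜ : Set E), Q.resolvent α f x = P.restrictedResolvent N α f x)
    {μ : @Measure E (univBorel E)} (hμ : @IsProbabilityMeasure E (univBorel E) μ) (hμN : μ N = 0) :
    L.lawOf μ {ω | ∀ t, PathSpace.coord t ω ∉ N} = 1 := by
  have : T1Space E := by
    obtain ⟨K, _, _, i, hi, -⟩ := hE
    exact hi.t1Space
  obtain ⟨ν, hν, hνμ⟩ := exists_map_val_eq (@MeasurableSet.compl E N (univBorel E) hN.1) μ hμ
    (by rwa [compl_compl])
  obtain ⟨Ω, mΩ, Pr, 𝓖, Y, hPr, hr, hY, h0⟩ := hQ ν hν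
  have hX := MarkovTransitionFunction.isMarkovProcess_of_map_val_kernel_eq
    (MarkovTransitionFunction.map_val_kernel_eq hE hP hN hQ hPQ) hY
  have hrX : ∀ ω, IsRightContinuous fun t => (Y t ω : E) := fun ω t =>
    continuous_subtype_val.continuousAt.comp_continuousWithinAt (hr ω t)
  have hlaw : L.lawOf μ = Pr.map (PathSpace.ofPaths (fun t ω => (Y t ω : E)) hrX) := by
    rw [← L.lawOf_eq_map hrX hX, ← hνμ, ← h0]
    congr 1
    exact @Measure.map_map _ _ _ mΩ (univBorel (Nᶜ : Set E)) (univBorel E) _ _ _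
      continuous_subtype_val.measurable_univBorel (hY.measurable 0)
  have hΦ := PathSpace.measurable_ofPaths hrX hX.measurable
  have := Measure.isProbabilityMeasure_map (μ := Pr) hΦ.aemeasurable
  rw [hlaw]
  refine le_antisymm prob_le_one ?_
  -- The event involves uncountably many times and need not be measurable. Its preimage is all of
  -- `Ω`, and an image measure of any set, read as outer measure, dominates the measure of the
  -- preimage.
  calc 1 = Pr (PathSpace.ofPaths (fun t ω => (Y t ω : E)) hrX ⁻¹'
        {ω | ∀ t, PathSpace.coord t ω ∉ N}) := by
        rw [← measure_univ (μ := Pr)]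
        congr 1
        exact (eq_univ_of_forall fun ω t => (Y t ω).2).symm
    _ ≤ _ := Measure.le_map_apply hΦ.aemeasurable _

end

theorem mainTheorem2 {E : Type*} [TopologicalSpace E] (hE : IsRadonSpace E)
    (P : MarkovTransitionFunction E) (hnormal : P.IsNormal) (hHD1 : P.HD1)
    (X : CanonicalRealization P)
    (N : Set E) (hN : P.IsWeaklyNegligible N)
    (hμ : ∃ μ : @MeasureTheory.Measure E (univBorel E),
      @MeasureTheory.IsProbabilityMeasure E (univBorel E) μ ∧ μ N = 0 ∧
      X.lawOf μ {ω | ∀ t, PathSpace.coord t ω ∉ N} ≠ 1) :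
    ¬ ∃ Q : MarkovTransitionFunction (Nᶜ : Set E), Q.HD1 ∧
      ∀ α : ℝ, 0 < α → ∀ f : (Nᶜ : Set E) → ENNReal,
        @Measurable (Nᶜ : Set E) ENNReal (univBorel (Nᶜ : Set E)) _ f →
        ∀ x : (Nᶜ : Set E), Q.resolvent α f x = P.restrictedResolvent N α f x := by
  rintro ⟨Q, hQ, hPQ⟩
  obtain ⟨μ, hμ, hμN, hne⟩ := hμ
  exact hne (X.lawOf_forall_notMem_eq_one hE hHD1 hN hQ hPQ hμ hμN)
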